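/- A Latin square of order $n$ is an $n\times n$ matrix $A$ with entries in $[n]=\{1,\dots,n\}$ such that every row and every column of $A$ is a permutation of $[n]$. For each symbol $k\in[n]$ let $\sigma_k\in S_n$ be the permutation giving the positions of $k$, i.e. $\sigma_k(i)=j$ if and only if $A_{ij}=k$. The sign of the Latin square is $(-1)^{n(n-1)/2}\prod_{k=1}^n\operatorname{sign}(\sigma_k)$, and the square is called even if its sign is $+1$ and odd if its sign is $-1$. Let $L(n)$, $L^{\mathrm{even}}(n)$ and $L^{\mathrm{odd}}(n)$ be the numbers of all, of even, and of odd Latin squares of order $n$, respectively. Then $$\left|L^{\mathrm{even}}(n)-L^{\mathrm{odd}}(n)\right|\le L(n)^{\frac12}\cdot\left(2e^{\frac14}\right)^{n^2(1+o(1))},$$ where $o(1)$ denotes a quantity, depending only on $n$, that tends to $0$ as $n\to\infty$. Moreover, the even and odd Latin squares are equinumerous to leading order: $L^{\mathrm{even}}(n)\sim L^{\mathrm{odd}}(n)$ as $n\to\infty$, that is, $L^{\mathrm{even}}(n)-L^{\mathrm{odd}}(n)=o(L^{\mathrm{odd}}(n))$. -/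

import Mathlib

open Filter Topology Asymptotics

/-- An `n × n` matrix with entries in an `n`-element alphabet is Latin if every row and every
column is a permutation of the alphabet. -/
def IsLatin {n : ℕ} (A : Matrix (Fin n) (Fin n) (Fin n)) : Prop :=
  (∀ i, Function.Bijective fun j => A i j) ∧ (∀ j, Function.Bijective fun i => A i j)

/-- Latin squares of order `n` (symbols, rows and columns are indexed by `Fin n`). -/
abbrev LatinSquare (n : ℕ) : Type :=
  {A : Matrix (Fin n) (Fin n) (Fin n) // IsLatin A}

namespace LatinSquare

variable {n : ℕ}

/-- The column in which the symbol `k` occurs in row `i`. -/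
noncomputable def column (S : LatinSquare n) (k i : Fin n) : Fin n :=
  (Equiv.ofBijective _ (S.2.1 i)).symm k

theorem entry_column (S : LatinSquare n) (k i : Fin n) : S.1 i (S.column k i) = k :=
  (Equiv.ofBijective _ (S.2.1 i)).apply_symm_apply k

theorem column_bijective (S : LatinSquare n) (k : Fin n) :
    Function.Bijective (S.column k) := by
  refine Finite.injective_iff_bijective.mp fun i i' h => ?_
  refine (S.2.2 (S.column k i)).injective ?_
  change S.1 i (S.column k i) = S.1 i' (S.column k i)
  rw [entry_column, h, entry_column]

/-- The permutation `σ_k` of the positions of the symbol `k`: it sends each row to the column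
in which `k` occurs in that row. -/
noncomputable def symbolPerm (S : LatinSquare n) (k : Fin n) : Equiv.Perm (Fin n) :=
  Equiv.ofBijective (S.column k) (S.column_bijective k)

theorem symbolPerm_eq_iff (S : LatinSquare n) (k i j : Fin n) :
    S.symbolPerm k i = j ↔ S.1 i j = k := by
  constructor
  · rintro rfl
    exact S.entry_column k i
  · intro h
    refine (S.2.1 i).injective ?_
    change S.1 i (S.column k i) = S.1 i j
    rw [entry_column, h]

/-- The sign `(-1)^(n(n-1)/2) ∏ₖ sign σ_k` of a Latin square. -/
noncomputable def sign (S : LatinSquare n) : ℤˣ :=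
  (-1) ^ (n * (n - 1) / 2) * ∏ k, Equiv.Perm.sign (S.symbolPerm k)

end LatinSquare

/-- The number of Latin squares of order `n`. -/
noncomputable def numLatin (n : ℕ) : ℕ :=
  Nat.card (LatinSquare n)

/-- The number of even Latin squares of order `n`. -/
noncomputable def numEvenLatin (n : ℕ) : ℕ :=
  Nat.card {S : LatinSquare n // S.sign = 1}

/-- The number of odd Latin squares of order `n`. -/
noncomputable def numOddLatin (n : ℕ) : ℕ :=
  Nat.card {S : LatinSquare n // S.sign = -1}

/-! Up to the global sign, `L^even - L^odd` is the coefficient of `∏ x_ij` in `det(X)^n`. Indeed,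
expanding the power runs over `n`-tuples of permutations weighted by their signs, and the tuples
covering every cell exactly once are the Latin squares.

This coefficient is bounded by a norm. In the Fischer inner product, multiplication by a variable is
adjoint to differentiation, so the squared norm of `det^n` comes from applying `det(∂)` repeatedly.
Cayley's identity `det(∂) det^(s+1) = (s+1)⋯(s+n) det^s`, obtained here from a Capelli-type
recursion, gives the value `∏_{i<n} (i+1)⋯(i+n) = exp(n²(log n + log 4 - 3/2 + o(1)))`. Its square
root bounds the discrepancy.

From the other side, `L(n) ≥ (n/e²)^(n²)`. A Latin rectangle is extended row by row, and the number
of extensions is the permanent of a matrix with constant line sums. Such permanents are bounded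
below by the `e⁻ⁿ` form of van der Waerden's conjecture, proved by Gurvits' capacity method for
stable polynomials.

Comparing exponents, `½(log n + log 4 - 3/2) = ½(log n - 2) + log 2 + 1/4`, which is the stated
inequality. Since the discrepancy is roughly `n^(n²/2)` while `L(n)` is roughly at least `n^(n²)`,
the discrepancy is also `o(L(n))`. -/

namespace MvPolynomial

/-! ### The Fischer inner product. -/

theorem pderiv_pderiv_comm {σ R : Type*} [CommRing R] (i j : σ) (f : MvPolynomial σ R) :
    pderiv i (pderiv j f) = pderiv j (pderiv i f) := by
  classical
  have h : ⁅(pderiv i : Derivation R (MvPolynomial σ R) (MvPolynomial σ R)),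
      (pderiv j : Derivation R (MvPolynomial σ R) (MvPolynomial σ R))⁆ = 0 := by
    refine MvPolynomial.derivation_ext fun k => ?_
    simp [Derivation.commutator_apply, pderiv_X, Pi.single_apply, apply_ite]
  have := congrArg (fun D => D f) h
  simpa [Derivation.commutator_apply, sub_eq_zero] using this

/-- The Fischer inner product on polynomials: distinct monomials are orthogonal, and the squared
norm of `X ^ m` is `∏ (m i)!`. -/
noncomputable def fischer {σ : Type*} [Fintype σ] :
    MvPolynomial σ ℝ →ₗ[ℝ] MvPolynomial σ ℝ →ₗ[ℝ] ℝ :=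
  (basisMonomials σ ℝ).constr ℝ fun m => (∏ i, ((m i).factorial : ℝ)) • lcoeff ℝ m

variable {σ : Type*} [Fintype σ]

theorem fischer_monomial (m : σ →₀ ℕ) (c : ℝ) (g : MvPolynomial σ ℝ) :
    fischer (monomial m c) g = c * ((∏ i, ((m i).factorial : ℝ)) * coeff m g) := by
  have h : monomial m c = c • basisMonomials σ ℝ m := by
    rw [coe_basisMonomials, smul_monomial, smul_eq_mul, mul_one]
  rw [h, map_smul, fischer, Module.Basis.constr_basis]
  rfl

/-- The weights `∏ (m i)!` are chosen for this adjointness: raising the exponent `m i` by one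
multiplies the weight by `m i + 1`, the factor that `∂ᵢ` produces. -/
theorem fischer_X_mul (i : σ) (f g : MvPolynomial σ ℝ) :
    fischer (X i * f) g = fischer f (pderiv i g) := by
  classical
  induction f using MvPolynomial.induction_on' with
  | add p q hp hq => simp only [mul_add, map_add, LinearMap.add_apply, hp, hq]
  | monomial m c =>
    rw [X, monomial_mul, fischer_monomial, fischer_monomial, coeff_pderiv, add_comm m]
    have : (∏ j, (((Finsupp.single i 1 + m : σ →₀ ℕ) j).factorial : ℝ))
        = (m i + 1) * ∏ j, ((m j).factorial : ℝ) := by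
      rw [← Finset.mul_prod_erase _ _ (Finset.mem_univ i),
        ← Finset.mul_prod_erase _ (fun j => ((m j).factorial : ℝ)) (Finset.mem_univ i), ← mul_assoc]
      congr 1
      · simp [add_comm 1, Nat.factorial_succ]
      · refine Finset.prod_congr rfl fun j hj => ?_
        simp [Finset.ne_of_mem_erase hj]
    rw [this]
    ring

/-- The norm is a sum of squared coefficients with weights at least 1, so any single term may be
kept and the rest dropped. -/
theorem coeff_sq_le_fischer_self (f : MvPolynomial σ ℝ) (m : σ →₀ ℕ) :
    coeff m f ^ 2 ≤ fischer f f := by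
  classical
  have h : fischer f f = ∑ m ∈ f.support, (∏ i, ((m i).factorial : ℝ)) * coeff m f ^ 2 := by
    conv_lhs => enter [1]; rw [f.as_sum]
    simp only [map_sum, LinearMap.sum_apply, fischer_monomial]
    exact Finset.sum_congr rfl fun _ _ => by ring
  have hn : ∀ m ∈ f.support, 0 ≤ (∏ i, ((m i).factorial : ℝ)) * coeff m f ^ 2 :=
    fun _ _ => by positivity
  rw [h]
  by_cases hm : m ∈ f.support
  · refine le_trans ?_ (Finset.single_le_sum hn hm)
    refine le_mul_of_one_le_left (sq_nonneg _) ?_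
    refine Finset.prod_induction _ (fun x : ℝ => 1 ≤ x) (fun _ _ => one_le_mul_of_one_le_of_one_le)
      le_rfl fun i _ => ?_
    exact_mod_cast Nat.succ_le_of_lt (Nat.factorial_pos _)
  · rw [notMem_support_iff.mp hm, zero_pow two_ne_zero]
    exact Finset.sum_nonneg hn

/-- The iterated partial derivative along the word `w`. -/
noncomputable def wordDeriv {σ : Type*} :
    ∀ {k : ℕ}, (Fin k → σ) → MvPolynomial σ ℝ →ₗ[ℝ] MvPolynomial σ ℝ
  | 0, _ => LinearMap.id
  | _ + 1, w => wordDeriv (Fin.tail w) ∘ₗ (pderiv (w 0)).toLinearMap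

theorem fischer_prod_X_mul {k : ℕ} (w : Fin k → σ) (f g : MvPolynomial σ ℝ) :
    fischer ((∏ i, X (w i)) * f) g = fischer f (wordDeriv w g) := by
  induction k generalizing g with
  | zero => simp [wordDeriv]
  | succ k ih =>
    rw [Fin.prod_univ_succ, mul_assoc, fischer_X_mul]
    exact ih (Fin.tail w) _

end MvPolynomial

/-! ### Polarizations, and the Capelli and Cayley identities. -/

open MvPolynomial

/-- Row polarization `∑ⱼ x_{aj} ∂/∂x_{bj}`. -/
noncomputable def polarization {n : ℕ} (a b : Fin n) :
    Derivation ℝ (MvPolynomial (Fin n × Fin n) ℝ) (MvPolynomial (Fin n × Fin n) ℝ) :=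
  ∑ j, (X (a, j) : MvPolynomial (Fin n × Fin n) ℝ) • pderiv (b, j)

theorem polarization_apply {n : ℕ} (a b : Fin n) (f : MvPolynomial (Fin n × Fin n) ℝ) :
    polarization a b f = ∑ j, X (a, j) * pderiv (b, j) f := by
  rw [polarization, ← Derivation.coeFnAddMonoidHom_apply, map_sum]
  simp

/-- The commutation relation `[∂_cj, E_ab] = δ_ca ∂_bj`, the source of every correction term in the
normal ordering below. -/
theorem pderiv_polarization {n : ℕ} (c a b j : Fin n) (f : MvPolynomial (Fin n × Fin n) ℝ) :
    pderiv (c, j) (polarization a b f) =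
      polarization a b (pderiv (c, j) f) + if c = a then pderiv (b, j) f else 0 := by
  classical
  simp only [polarization_apply, map_sum, pderiv_mul, pderiv_X, Finset.sum_add_distrib,
    pderiv_pderiv_comm (c, j)]
  rw [add_comm]
  congr 1
  by_cases h : c = a
  · subst h
    simp [Pi.single_apply]
  · simp [h, Ne.symm h]

theorem Derivation.map_prod_update {ι R A : Type*} [DecidableEq ι] [CommRing R] [CommRing A]
    [Algebra R A] (D : Derivation R A A) (s : Finset ι) (f : ι → A) :
    D (∏ i ∈ s, f i) = ∑ i ∈ s, ∏ j ∈ s, Function.update f i (D (f i)) j := by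
  induction s using Finset.induction_on with
  | empty => simp
  | insert a s ha ih =>
    rw [Finset.prod_insert ha, D.leibniz, ih, Finset.sum_insert ha, Finset.prod_insert ha,
      Function.update_self, smul_eq_mul, smul_eq_mul, add_comm, Finset.mul_sum, mul_comm (D _),
      mul_comm (∏ i ∈ s, f i)]
    congr 1
    · rw [mul_comm]
      congr 1
      exact Finset.prod_congr rfl fun j hj => by
        rw [Function.update_of_ne (ne_of_mem_of_not_mem hj ha)]
    · refine Finset.sum_congr rfl fun i hi => ?_
      rw [Finset.prod_insert ha, Function.update_of_ne (ne_of_mem_of_not_mem hi ha).symm]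

theorem Derivation.map_det {m R A : Type*} [Fintype m] [DecidableEq m] [CommRing R] [CommRing A]
    [Algebra R A] (D : Derivation R A A) (M : Matrix m m A) :
    D M.det = ∑ i, (M.updateCol i fun r => D (M r i)).det := by
  simp only [Matrix.det_apply, map_sum]
  rw [Finset.sum_comm]
  refine Finset.sum_congr rfl fun σ _ => ?_
  rw [← Finset.smul_sum, Units.smul_def, Units.smul_def, map_zsmul, D.map_prod_update]
  congr 1
  refine Finset.sum_congr rfl fun i _ => Finset.prod_congr rfl fun j _ => ?_
  by_cases h : j = i
  · subst h; simp
  · simp [h]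

/-- The determinant of the generic `n × n` matrix. -/
noncomputable def genericDet (n : ℕ) : MvPolynomial (Fin n × Fin n) ℝ :=
  (Matrix.mvPolynomialX (Fin n) (Fin n) ℝ).det

theorem polarization_X {n : ℕ} (a b i j : Fin n) :
    polarization a b (X (i, j)) = if i = b then X (a, j) else 0 := by
  classical
  rw [polarization_apply]
  by_cases h : i = b
  · subst h; simp [pderiv_X, Pi.single_apply]
  · simp [pderiv_X, h]

/-- Polarizing replaces row `b` by row `a`, which repeats a row unless `a = b`. The transpose
appears because `Derivation.map_det` differentiates by columns. -/
theorem polarization_genericDet {n : ℕ} (a b : Fin n) :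
    polarization a b (genericDet n) = if a = b then genericDet n else 0 := by
  rw [genericDet, ← Matrix.det_transpose, Derivation.map_det, Finset.sum_eq_single b]
  · have : ((Matrix.mvPolynomialX (Fin n) (Fin n) ℝ).transpose.updateCol b fun r =>
        polarization a b ((Matrix.mvPolynomialX (Fin n) (Fin n) ℝ).transpose r b)) =
        ((Matrix.mvPolynomialX (Fin n) (Fin n) ℝ).updateRow b
          (Matrix.mvPolynomialX (Fin n) (Fin n) ℝ a)).transpose := by
      ext1 i j
      simp [Matrix.updateCol_apply, Matrix.updateRow_apply, polarization_X]
    rw [this, Matrix.det_transpose]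
    split_ifs with h
    · subst h; simp
    · exact Matrix.det_updateRow_eq_zero h
  · intro i _ hi
    refine Matrix.det_eq_zero_of_column_eq_zero i fun r => ?_
    simp [polarization_X, hi]
  · simp

theorem polarization_genericDet_pow {n : ℕ} (a b : Fin n) (s : ℕ) :
    polarization a b (genericDet n ^ s) = if a = b then (s : ℝ) • genericDet n ^ s else 0 := by
  rw [Derivation.leibniz_pow, polarization_genericDet]
  split_ifs
  · cases s with
    | zero => simp
    | succ s => rw [smul_eq_mul, Nat.add_sub_cancel, ← pow_succ, Nat.cast_smul_eq_nsmul]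
  · simp

/-- The normally ordered product of the polarizations along `(a 0, b 0), …, (a (k-1), b (k-1))`. -/
noncomputable def normalOrdered {n : ℕ} : ∀ {k : ℕ}, (Fin k → Fin n) → (Fin k → Fin n) →
    MvPolynomial (Fin n × Fin n) ℝ →ₗ[ℝ] MvPolynomial (Fin n × Fin n) ℝ
  | 0, _, _ => LinearMap.id
  | _ + 1, a, b => ∑ j, LinearMap.mulLeft ℝ (X (a 0, j)) ∘ₗ
      normalOrdered (Fin.tail a) (Fin.tail b) ∘ₗ (pderiv (b 0, j)).toLinearMap

theorem normalOrdered_succ {n k : ℕ} (a b : Fin (k + 1) → Fin n)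
    (f : MvPolynomial (Fin n × Fin n) ℝ) :
    normalOrdered a b f =
      ∑ j, X (a 0, j) * normalOrdered (Fin.tail a) (Fin.tail b) (pderiv (b 0, j) f) := by
  simp [normalOrdered]

/-- Moving the derivatives past the variables `x_αj` of the polarization leaves the longer normally
ordered product, plus one term for each derivative along row `α`, which the commutator turns into a
derivative along row `β`. -/
theorem normalOrdered_polarization {n k : ℕ} (a b : Fin k → Fin n) (α β : Fin n)
    (f : MvPolynomial (Fin n × Fin n) ℝ) :
    normalOrdered a b (polarization α β f) =
      normalOrdered (Fin.cons α a : Fin (k + 1) → Fin n) (Fin.cons β b : Fin (k + 1) → Fin n) f +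
      ∑ i, if b i = α then normalOrdered a (Function.update b i β) f else 0 := by
  induction k generalizing f with
  | zero => simp [normalOrdered, polarization_apply]
  | succ k ih =>
    rw [normalOrdered_succ a b, Fin.sum_univ_succ]
    simp only [pderiv_polarization, map_add, ih, mul_add, Finset.sum_add_distrib]
    refine (add_assoc _ _ _).trans
      (congrArg₂ _ ?_ ((add_comm _ _).trans (congrArg₂ _ ?_ ?_)))
    · simp only [normalOrdered_succ, Fin.tail_cons, Fin.cons_zero, Finset.mul_sum]
      rw [Finset.sum_comm]
      refine Finset.sum_congr rfl fun i _ => Finset.sum_congr rfl fun j _ => ?_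
      rw [mul_left_comm, pderiv_pderiv_comm (b 0, j)]
    · split_ifs
      · rw [normalOrdered_succ]
        simp
      · simp
    · simp only [Finset.mul_sum]
      rw [Finset.sum_comm]
      refine Finset.sum_congr rfl fun i _ => ?_
      by_cases h : b i.succ = α
      · rw [normalOrdered_succ]
        simp [Fin.tail, h]
        rfl
      · simp [Fin.tail, h]

/-- The normally ordered determinant of the polarizations between the rows `e 0, …, e (k-1)`. -/
noncomputable def capelli {n k : ℕ} (e : Fin k → Fin n) :
    MvPolynomial (Fin n × Fin n) ℝ →ₗ[ℝ] MvPolynomial (Fin n × Fin n) ℝ :=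
  ∑ τ : Equiv.Perm (Fin k), ((τ.sign : ℤ) : ℝ) • normalOrdered (e ∘ τ) e

/-- The determinant is split according to `τ 0`, and the polarization along `(e (τ 0), e 0)` acts
first. If `τ 0 = 0` it multiplies `det^s` by `s`, without correction. If `τ 0 = q + 1` it kills
`det^s`, and only the correction at index `q` survives; its minus sign cancels the sign of the
transposition. -/
theorem capelli_succ_genericDet_pow {n k : ℕ} (e : Fin (k + 1) → Fin n)
    (he : Function.Injective e) (s : ℕ) :
    capelli e (genericDet n ^ s) = (s : ℝ) • capelli (Fin.tail e) (genericDet n ^ s) +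
      ∑ q, capelli (Function.update (Fin.tail e) q (e 0)) (genericDet n ^ s) := by
  have key (a b : Fin (k + 1) → Fin n) (f : MvPolynomial (Fin n × Fin n) ℝ) :
      normalOrdered a b f = normalOrdered (Fin.tail a) (Fin.tail b) (polarization (a 0) (b 0) f) -
        ∑ i : Fin k, if b i.succ = a 0 then
          normalOrdered (Fin.tail a) (Function.update (Fin.tail b) i (b 0)) f else 0 := by
    rw [normalOrdered_polarization, Fin.cons_self_tail, Fin.cons_self_tail]
    exact (add_sub_cancel_right _ _).symm
  have htail (σ : Equiv.Perm (Fin k)) :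
      Fin.tail (e ∘ Equiv.Perm.decomposeFin.symm (0, σ)) = Fin.tail e ∘ σ := by
    ext i; simp [Fin.tail]
  have htail' (q : Fin k) (σ : Equiv.Perm (Fin k)) :
      Fin.tail (e ∘ Equiv.Perm.decomposeFin.symm (q.succ, σ)) =
        Function.update (Fin.tail e) q (e 0) ∘ σ := by
    ext i
    simp only [Fin.tail, Function.comp, Equiv.Perm.decomposeFin_symm_apply_succ,
      Function.update_apply, Equiv.swap_apply_def, Fin.succ_ne_zero, Fin.succ_inj, if_false]
    split_ifs <;> rfl
  simp only [capelli, LinearMap.sum_apply, LinearMap.smul_apply]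
  rw [← Equiv.Perm.decomposeFin.symm.sum_comp, Fintype.sum_prod_type, Fin.sum_univ_succ]
  congr 1
  · rw [Finset.smul_sum]
    refine Finset.sum_congr rfl fun σ _ => ?_
    rw [key, htail]
    simp [polarization_genericDet_pow, he.eq_iff, -Derivation.leibniz_pow]
    rw [smul_comm]
  · refine Finset.sum_congr rfl fun q _ => Finset.sum_congr rfl fun σ _ => ?_
    rw [key, htail']
    simp [polarization_genericDet_pow, he.eq_iff, -Derivation.leibniz_pow]

/-- By induction the value does not depend on the injective word `e`, so the `k + 1` terms of the
recursion combine to the new factor `s + k`. -/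
theorem capelli_genericDet_pow {n k : ℕ} (e : Fin k → Fin n) (he : Function.Injective e) (s : ℕ) :
    capelli e (genericDet n ^ s) = (s.ascFactorial k : ℝ) • genericDet n ^ s := by
  induction k with
  | zero => simp [capelli, normalOrdered]
  | succ k ih =>
    have h0 : Function.Injective (Fin.tail e) := he.comp (Fin.succ_injective _)
    rw [capelli_succ_genericDet_pow e he, ih _ h0]
    have (q : Fin k) : Function.Injective (Function.update (Fin.tail e) q (e 0)) := by
      intro i j hij
      simp only [Function.update_apply, Fin.tail] at hij
      split_ifs at hij with h1 h2 h2
      · rw [h1, h2]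
      · exact absurd (he hij) (Fin.succ_ne_zero _).symm
      · exact absurd (he hij) (Fin.succ_ne_zero _)
      · exact Fin.succ_injective _ (he hij)
    rw [Finset.sum_congr rfl fun q _ => ih _ (this q)]
    rw [Finset.sum_const, Finset.card_univ, Fintype.card_fin, ← Nat.cast_smul_eq_nsmul ℝ, smul_smul,
      smul_smul, ← add_smul, Nat.ascFactorial_succ]
    push_cast
    ring_nf

theorem normalOrdered_eq_sum {n k : ℕ} (a b : Fin k → Fin n)
    (f : MvPolynomial (Fin n × Fin n) ℝ) :
    normalOrdered a b f =
      ∑ j : Fin k → Fin n, (∏ i, X (a i, j i)) * wordDeriv (fun i => (b i, j i)) f := by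
  induction k generalizing f with
  | zero => simp [normalOrdered, wordDeriv]
  | succ k ih =>
    rw [normalOrdered_succ, ← (Fin.consEquiv fun _ => Fin n).sum_comp, Fintype.sum_prod_type]
    refine Finset.sum_congr rfl fun j _ => ?_
    rw [ih, Finset.mul_sum]
    refine Finset.sum_congr rfl fun l _ => ?_
    rw [Fin.prod_univ_succ, mul_assoc]
    simp only [Fin.consEquiv, Equiv.coe_fn_mk, Fin.cons_zero, Fin.cons_succ, Fin.tail, wordDeriv,
      LinearMap.comp_apply]
    rfl

/-- The differential operator `det(∂/∂x_{ij})`. -/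
noncomputable def cayley (n : ℕ) :
    MvPolynomial (Fin n × Fin n) ℝ →ₗ[ℝ] MvPolynomial (Fin n × Fin n) ℝ :=
  ∑ τ : Equiv.Perm (Fin n), ((τ.sign : ℤ) : ℝ) • wordDeriv fun i => (i, τ i)

/-- Adjointness of variables and derivatives, applied to each term of the determinant. -/
theorem fischer_genericDet_mul {n : ℕ} (f g : MvPolynomial (Fin n × Fin n) ℝ) :
    fischer (genericDet n * f) g = fischer f (cayley n g) := by
  rw [genericDet, ← Matrix.det_transpose, Matrix.det_apply, Finset.sum_mul, map_sum,
    LinearMap.sum_apply, cayley, LinearMap.sum_apply, map_sum]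
  refine Finset.sum_congr rfl fun τ _ => ?_
  rw [Units.smul_def, smul_mul_assoc, map_zsmul, LinearMap.smul_apply, LinearMap.smul_apply,
    map_smul, ← fischer_prod_X_mul]
  simp [Matrix.mvPolynomialX, zsmul_eq_mul]

/-- For a fixed column word `j`, the signed sum over row permutations is the determinant of the
generic matrix with columns selected by `j`. It vanishes unless `j` is a permutation, and is then
the sign of `j` times `det`. -/
theorem capelli_id {n : ℕ} (f : MvPolynomial (Fin n × Fin n) ℝ) :
    capelli (id : Fin n → Fin n) f = genericDet n * cayley n f := by
  have h (j : Fin n → Fin n) :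
      ∑ τ : Equiv.Perm (Fin n), ((τ.sign : ℤ) : ℝ) •
        (∏ i, (X (τ i, j i) : MvPolynomial (Fin n × Fin n) ℝ)) =
      ((Matrix.mvPolynomialX (Fin n) (Fin n) ℝ).submatrix id j).det := by
    rw [Matrix.det_apply]
    refine Finset.sum_congr rfl fun τ _ => ?_
    rw [Units.smul_def, ← Int.cast_smul_eq_zsmul ℝ]
    simp [Matrix.mvPolynomialX]
  simp only [capelli, LinearMap.sum_apply, LinearMap.smul_apply, normalOrdered_eq_sum,
    Finset.smul_sum, id, Function.comp]
  rw [Finset.sum_comm]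
  simp only [← smul_mul_assoc, ← Finset.sum_mul, h]
  rw [cayley, LinearMap.sum_apply, Finset.mul_sum]
  symm
  refine Finset.sum_bij_ne_zero (fun τ _ _ => ⇑τ) (fun _ _ _ => Finset.mem_univ _)
    (fun _ _ _ _ _ _ h => Equiv.coe_fn_injective h) ?_ ?_
  · intro j _ hj
    have hinj : Function.Injective j := by
      intro i i' hii
      by_contra hne
      refine hj ?_
      rw [Matrix.det_zero_of_column_eq hne fun r => by simp [hii], zero_mul]
    let τ := Equiv.ofBijective j (Finite.injective_iff_bijective.mp hinj)
    refine ⟨τ, Finset.mem_univ _, ?_, rfl⟩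
    contrapose! hj
    rw [show j = ⇑τ from rfl, Matrix.det_permute', ← hj, genericDet, LinearMap.smul_apply,
      Algebra.smul_def]
    simp
    ring
  · intro τ _ _
    rw [Matrix.det_permute', genericDet, LinearMap.smul_apply, Algebra.smul_def]
    simp
    ring

/-- Cayley's identity: one factor `det` cancels from the Capelli evaluation, polynomials forming a
domain. -/
theorem cayley_genericDet_pow_succ (n s : ℕ) :
    cayley n (genericDet n ^ (s + 1)) = ((s + 1).ascFactorial n : ℝ) • genericDet n ^ s := by
  have h := capelli_genericDet_pow (id : Fin n → Fin n) Function.injective_id (s + 1)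
  rw [capelli_id, pow_succ' _ s, ← mul_smul_comm, ← pow_succ'] at h
  exact mul_left_cancel₀ (Matrix.det_mvPolynomialX_ne_zero (Fin n) ℝ) h

theorem fischer_genericDet_pow (n s : ℕ) :
    fischer (genericDet n ^ s) (genericDet n ^ s) =
      ∏ i ∈ Finset.range s, ((i + 1).ascFactorial n : ℝ) := by
  induction s with
  | zero =>
    rw [pow_zero, ← C_1, ← monomial_zero', fischer_monomial]
    simp
  | succ s ih =>
    conv_lhs => enter [1]; rw [pow_succ']
    rw [fischer_genericDet_mul, cayley_genericDet_pow_succ, map_smul, ih, Finset.prod_range_succ,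
      smul_eq_mul, mul_comm]

theorem coeff_genericDet_pow_sq_le (n s : ℕ) (m : Fin n × Fin n →₀ ℕ) :
    coeff m (genericDet n ^ s) ^ 2 ≤ ∏ i ∈ Finset.range s, ((i + 1).ascFactorial n : ℝ) :=
  (coeff_sq_le_fischer_self _ m).trans_eq (fischer_genericDet_pow n s)

/-! ### The signed count of Latin squares as a coefficient. -/

theorem genericDet_eq_sum (n : ℕ) :
    genericDet n = ∑ τ : Equiv.Perm (Fin n), monomial (∑ i, Finsupp.single (i, τ i) 1)
      ((τ.sign : ℤ) : ℝ) := by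
  rw [genericDet, ← Matrix.det_transpose, Matrix.det_apply]
  refine Finset.sum_congr rfl fun τ _ => ?_
  rw [← mul_one ((τ.sign : ℤ) : ℝ), ← smul_eq_mul, ← smul_monomial, monomial_sum_one,
    Units.smul_def, Int.cast_smul_eq_zsmul]
  rfl

theorem genericDet_pow_eq_sum (n s : ℕ) :
    genericDet n ^ s = ∑ p : Fin s → Equiv.Perm (Fin n),
      monomial (∑ k, ∑ i, Finsupp.single (i, p k i) 1) (∏ k, (((p k).sign : ℤ) : ℝ)) := by
  rw [genericDet_eq_sum, ← Fin.prod_const, Finset.prod_univ_sum, Fintype.piFinset_univ]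
  refine Finset.sum_congr rfl fun p _ => ?_
  rw [monomial_sum_prod]

namespace LatinSquare

theorem symbolPerm_injective {n : ℕ} :
    Function.Injective (fun S : LatinSquare n => S.symbolPerm) := by
  intro S T h
  refine Subtype.ext (Matrix.ext fun i j => ?_)
  refine ((T.symbolPerm_eq_iff (S.1 i j) i j).mp ?_).symm
  rw [show T.symbolPerm = S.symbolPerm from h.symm]
  exact (S.symbolPerm_eq_iff _ i j).mpr rfl

theorem sum_single_symbolPerm {n : ℕ} (S : LatinSquare n) :
    ∑ k, ∑ i, Finsupp.single (i, S.symbolPerm k i) 1 =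
      Finsupp.equivFunOnFinite.symm fun _ : Fin n × Fin n => 1 := by
  ext ⟨i, j⟩
  simp [Finsupp.single_apply, Finsupp.finsetSum_apply, symbolPerm_eq_iff, ite_and]

/-- Exponent one in each variable means that every cell is covered by some `p k`. Coverage alone
suffices: the symbol chosen in each cell makes rows and columns injective, because each `p k` is a
permutation. -/
theorem exists_symbolPerm_eq {n : ℕ} (p : Fin n → Equiv.Perm (Fin n))
    (hp : ∑ k, ∑ i, Finsupp.single (i, p k i) 1 =
      Finsupp.equivFunOnFinite.symm fun _ : Fin n × Fin n => 1) :
    ∃ S : LatinSquare n, S.symbolPerm = p := by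
  have h (i j) : ∃ k, p k i = j := by
    have := DFunLike.congr_fun hp (i, j)
    by_contra! hk
    simp [Finsupp.single_apply, Finsupp.finsetSum_apply, ite_and, hk] at this
  choose A hA using h
  have hr (i) : Function.Bijective fun j => A i j :=
    Finite.injective_iff_bijective.mp fun j j' hj => by
      rw [← hA i j, ← hA i j']
      exact congrArg (fun k => p k i) hj
  have hc (j) : Function.Bijective fun i => A i j :=
    Finite.injective_iff_bijective.mp fun i i' hi => by
      refine (p (A i j)).injective ?_
      rw [hA, show A i j = A i' j from hi, hA]
  refine ⟨⟨Matrix.of A, hr, hc⟩, funext fun k => Equiv.ext fun i => ?_⟩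
  rw [symbolPerm_eq_iff]
  obtain ⟨j, hj⟩ := (hr i).surjective k
  simp only at hj
  rw [← hj, hA]
  rfl

open scoped Classical in
-- Only the tuples whose monomial is `∏ x_ij` contribute, and these are the families `σ_k` of Latin
-- squares.
theorem coeff_genericDet_pow_self (n : ℕ) :
    coeff (Finsupp.equivFunOnFinite.symm fun _ => 1) (genericDet n ^ n) =
      ∑ S : LatinSquare n, ∏ k, (((S.symbolPerm k).sign : ℤ) : ℝ) := by
  rw [genericDet_pow_eq_sum, coeff_sum]
  symm
  refine Fintype.sum_of_injective _ symbolPerm_injective _ _ (fun p hp => ?_) fun S => ?_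
  · rw [coeff_monomial, if_neg]
    exact fun h => hp (exists_symbolPerm_eq p h)
  · rw [coeff_monomial, if_pos (sum_single_symbolPerm S)]

end LatinSquare

open scoped Classical in
theorem numEvenLatin_sub_numOddLatin (n : ℕ) :
    (numEvenLatin n : ℝ) - numOddLatin n = ∑ S : LatinSquare n, ((S.sign : ℤ) : ℝ) := by
  rw [numEvenLatin, numOddLatin, Nat.card_eq_fintype_card, Nat.card_eq_fintype_card,
    Fintype.card_subtype, Fintype.card_subtype, Finset.natCast_card_filter,
    Finset.natCast_card_filter, ← Finset.sum_sub_distrib]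
  refine Finset.sum_congr rfl fun S _ => ?_
  rcases Int.units_eq_one_or S.sign with h | h <;> simp [h]

open scoped Classical in
theorem numEvenLatin_add_numOddLatin (n : ℕ) :
    (numEvenLatin n : ℝ) + numOddLatin n = numLatin n := by
  rw [numEvenLatin, numOddLatin, numLatin, Nat.card_eq_fintype_card, Nat.card_eq_fintype_card,
    Nat.card_eq_fintype_card,
    Fintype.card_subtype, Fintype.card_subtype, Finset.natCast_card_filter,
    Finset.natCast_card_filter, ← Finset.sum_add_distrib, ← Finset.card_univ, Finset.cast_card]
  refine Finset.sum_congr rfl fun S _ => ?_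
  rcases Int.units_eq_one_or S.sign with h | h <;> simp [h]

/-- Squaring removes the global sign `(-1)^(n(n-1)/2)`. -/
theorem sq_numEvenLatin_sub_numOddLatin_le (n : ℕ) :
    ((numEvenLatin n : ℝ) - numOddLatin n) ^ 2 ≤
      ∏ i ∈ Finset.range n, ((i + 1).ascFactorial n : ℝ) := by
  classical
  refine le_trans (le_of_eq ?_) (coeff_genericDet_pow_sq_le n n
    (Finsupp.equivFunOnFinite.symm fun _ => 1))
  have h : (numEvenLatin n : ℝ) - numOddLatin n = (-1) ^ (n * (n - 1) / 2) *
      ∑ S : LatinSquare n, ∏ k, (((S.symbolPerm k).sign : ℤ) : ℝ) := by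
    rw [numEvenLatin_sub_numOddLatin, Finset.mul_sum]
    refine Finset.sum_congr rfl fun S _ => ?_
    simp [LatinSquare.sign]
  rw [LatinSquare.coeff_genericDet_pow_self, h, mul_pow, ← pow_mul, mul_comm _ 2, pow_mul]
  simp

/-! ### Stable polynomials and Gurvits' capacity inequality. -/

namespace MvPolynomial

variable {σ : Type*}

theorem aeval_smul_of_isHomogeneous {A : Type*} [CommRing A] [Algebra ℝ A] [Fintype σ]
    {f : MvPolynomial σ ℝ} {m : ℕ} (hf : f.IsHomogeneous m) (s : A) (z : σ → A) :
    aeval (s • z) f = s ^ m * aeval z f := by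
  simp only [aeval_def, eval₂_eq', Finset.mul_sum]
  refine Finset.sum_congr rfl fun d hd => ?_
  have : ∑ i, d i = m := by
    rw [← Finsupp.degree_eq_sum, Finsupp.degree_eq_weight_one]
    exact hf (mem_support_iff.mp hd)
  simp only [Pi.smul_apply, smul_eq_mul, mul_pow, Finset.prod_mul_distrib, Finset.prod_pow_eq_pow_sum,
    this]
  ring

/-- The restriction of `f` to the line through `z` in the direction of the `j`-th axis. -/
noncomputable def axisLine [DecidableEq σ] {A : Type*} [CommRing A] [Algebra ℝ A] (z : σ → A)
    (j : σ) : MvPolynomial σ ℝ →ₐ[ℝ] Polynomial A :=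
  aeval fun i => Polynomial.C (z i) + Pi.single (M := fun _ => Polynomial A) j Polynomial.X i

section axisLine

variable [DecidableEq σ] {A : Type*} [CommRing A] [Algebra ℝ A] (z : σ → A) (j : σ)
  (f : MvPolynomial σ ℝ)

theorem eval_axisLine (t : A) : (axisLine z j f).eval t = aeval (z + Pi.single j t) f := by
  induction f using MvPolynomial.induction_on with
  | C a => simp [axisLine, Polynomial.algebraMap_apply]
  | add p q hp hq => simp [hp, hq]
  | mul_X p i hp =>
    rw [map_mul, Polynomial.eval_mul, hp, map_mul, aeval_X, axisLine, aeval_X]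
    by_cases h : i = j
    · subst h; simp
    · simp [h]

theorem derivative_axisLine :
    (axisLine z j f).derivative = axisLine z j (pderiv j f) := by
  induction f using MvPolynomial.induction_on with
  | C a => simp [axisLine, Polynomial.algebraMap_apply]
  | add p q hp hq => simp [hp, hq]
  | mul_X p i hp =>
    rw [map_mul, Polynomial.derivative_mul, hp, pderiv_mul, map_add, map_mul, map_mul]
    congr 2
    by_cases h : i = j
    · subst h; simp [axisLine]
    · simp [axisLine, h, pderiv_X_of_ne h]

theorem map_axisLine {B : Type*} [CommRing B] [Algebra ℝ B] (φ : A →ₐ[ℝ] B) :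
    (axisLine z j f).map (φ : A →+* B) = axisLine (φ ∘ z) j f := by
  induction f using MvPolynomial.induction_on with
  | C a => simp [axisLine, Polynomial.algebraMap_apply]
  | add p q hp hq => simp [hp, hq]
  | mul_X p i hp =>
    rw [map_mul, Polynomial.map_mul, hp, map_mul]
    congr 1
    by_cases h : i = j
    · subst h; simp [axisLine]
    · simp [axisLine, h]

end axisLine

/-- `f` has no zeros in the closed upper half-space other than real ones. -/
def IsStable (f : MvPolynomial σ ℝ) : Prop :=
  ∀ z : σ → ℂ, (∀ i, 0 ≤ (z i).im) → (∃ i, 0 < (z i).im) → aeval z f ≠ 0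

/-- Gauss–Lucas along the `j`-th axis: for `z` as in the definition of stability, all zeros of `t ↦
f(z + t e_j)` have negative imaginary part, hence so do those of its derivative, and `0` is not
among them. -/
theorem IsStable.pderiv [Fintype σ] {f : MvPolynomial σ ℝ} (hf : f.IsStable) {m : ℕ}
    (hm : f.IsHomogeneous (m + 1)) (j : σ) : (pderiv j f).IsStable := by
  classical
  intro z hz hz' h0
  set g := axisLine z j f with hg
  have hroot (t : ℂ) (ht : g.eval t = 0) : t.im < 0 := by
    by_contra! hcon
    rw [hg, eval_axisLine] at ht
    have him (i : σ) : ((z + Pi.single j t : σ → ℂ) i).im = (z i).im + if i = j then t.im else 0 := by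
      by_cases h : i = j
      · subst h; simp
      · simp [h]
    refine hf _ (fun i => ?_) ?_ ht
    · rw [him]
      have := hz i
      split_ifs <;> positivity
    · obtain ⟨i, hi⟩ := hz'
      refine ⟨i, ?_⟩
      rw [him]
      split_ifs <;> positivity
  -- If the restriction were constant, homogeneity would give `f(s z + e_j) = s^(m+1) f(z)` for `s ≠
  -- 0`. Letting `s → 0` yields `f(e_j) = 0`, so `f(i e_j) = 0`, against stability.
  have hdeg : 0 < g.degree := by
    by_contra! hcon
    have hconst (t : ℂ) : aeval (z + Pi.single j t) f = aeval z f := by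
      rw [← eval_axisLine z j f, ← hg, Polynomial.eq_C_of_degree_le_zero hcon, Polynomial.eval_C,
        ← Polynomial.eval_C (a := g.coeff 0) (x := 0), ← Polynomial.eq_C_of_degree_le_zero hcon, hg,
        eval_axisLine, Pi.single_zero, add_zero]
    have hscale : (fun s : ℂ => aeval (s • z + Pi.single j 1) f) =
        fun s : ℂ => s ^ (m + 1) * aeval z f := by
      refine Continuous.ext_on (dense_compl_singleton (0 : ℂ)) ?_ (by fun_prop) fun s hs => ?_
      · simp only [aeval_def, eval₂_eq']
        fun_prop
      · have hs' : s ≠ 0 := hs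
        have : s • z + Pi.single j 1 = s • (z + Pi.single j s⁻¹) := by
          rw [smul_add, ← Pi.single_smul, smul_eq_mul, mul_inv_cancel₀ hs']
        simp only [this]
        rw [aeval_smul_of_isHomogeneous hm, hconst]
    have h1 : aeval (Pi.single j (1 : ℂ)) f = 0 := by
      have := congrFun hscale 0
      simpa using this
    refine hf (Complex.I • Pi.single j (1 : ℂ)) (fun i => ?_) ⟨j, by simp⟩ ?_
    · by_cases h : i = j
      · subst h; simp
      · simp [h]
    · rw [aeval_smul_of_isHomogeneous hm, h1, mul_zero]
  have hd0 : g.derivative ≠ 0 := by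
    intro h
    exact (Polynomial.natDegree_pos_iff_degree_pos.mpr hdeg).ne'
      (Polynomial.derivative_eq_zero.mp h)
  have hmem : (0 : ℂ) ∈ g.derivative.rootSet ℂ := by
    rw [Polynomial.mem_rootSet]
    refine ⟨hd0, ?_⟩
    rw [Polynomial.coe_aeval_eq_eval, hg, derivative_axisLine, eval_axisLine, Pi.single_zero,
      add_zero, h0]
  have hconv : convexHull ℝ (g.rootSet ℂ) ⊆ {z : ℂ | z.im < 0} := by
    refine convexHull_min (fun t ht => hroot t ?_) (convex_halfSpace_im_lt 0)
    rw [Polynomial.mem_rootSet, Polynomial.coe_aeval_eq_eval] at ht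
    exact ht.2
  simpa using hconv (Polynomial.rootSet_derivative_subset_convexHull_rootSet hdeg hmem)

/-- Stable homogeneous polynomials with nonnegative coefficients are positive on the nonzero
vectors of the nonnegative orthant. -/
theorem IsStable.aeval_pos [Fintype σ] {f : MvPolynomial σ ℝ} (hf : f.IsStable) {m : ℕ}
    (hm : f.IsHomogeneous m) (hc : ∀ d, 0 ≤ coeff d f) {y : σ → ℝ} (hy : ∀ i, 0 ≤ y i)
    (hy' : ∃ i, 0 < y i) : 0 < aeval y f := by
  have h0 : 0 ≤ aeval y f := by
    rw [aeval_def, eval₂_eq']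
    refine Finset.sum_nonneg fun d _ => mul_nonneg (hc d) (Finset.prod_nonneg fun i _ => ?_)
    exact pow_nonneg (hy i) _
  refine h0.lt_of_ne' fun h => ?_
  refine hf (Complex.I • fun i => (y i : ℂ)) (fun i => ?_) ?_ ?_
  · simpa using hy i
  · simpa using hy'
  · rw [aeval_smul_of_isHomogeneous hm]
    have : aeval (fun i => (y i : ℂ)) f = ((aeval y f : ℝ) : ℂ) := by
      have := aeval_algebraMap_apply (A := ℝ) ℂ y f
      simpa [Function.comp_def] using this
    rw [this, h, Complex.ofReal_zero, mul_zero]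

/-- Non-real roots of a real polynomial come in conjugate pairs, and stability excludes the one in
the upper half-plane. -/
theorem IsStable.splits_axisLine [DecidableEq σ] {f : MvPolynomial σ ℝ} (hf : f.IsStable)
    (x : σ → ℝ) (j : σ) : (axisLine x j f).Splits := by
  refine Polynomial.Splits.of_splits_map (Complex.ofRealAm : ℝ →+* ℂ) (IsAlgClosed.splits _) ?_
  have hup (t : ℂ) (ht : 0 < t.im) : aeval ((fun i => (x i : ℂ)) + Pi.single j t) f ≠ 0 := by
    refine hf _ (fun i => ?_) ⟨j, by simpa using ht⟩
    by_cases h : i = j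
    · subst h; simpa using ht.le
    · simp [h]
  intro t ht
  have ht0 := Polynomial.isRoot_of_mem_roots ht
  rw [map_axisLine, Polynomial.IsRoot.def, eval_axisLine] at ht0
  have h1 : ¬ 0 < t.im := fun h => hup t h ht0
  have h2 : ¬ 0 < (starRingEnd ℂ t).im := by
    intro h
    refine hup _ h ?_
    have := congrArg Complex.conjAe.toAlgHom ht0
    rw [map_zero, comp_aeval_apply] at this
    rw [← this]
    congr 2
    ext i
    by_cases h : i = j
    · subst h; simp
    · simp [h]
  rw [Complex.conj_im] at h2
  exact ⟨t.re, Complex.ext (by simp) (by simp; linarith)⟩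

end MvPolynomial

/-- The one-variable capacity inequality for real-rooted polynomials. -/
theorem Polynomial.Splits.le_exp_one_mul_derivative {q : Polynomial ℝ} (hq : q.Splits)
    (hpos : ∀ t, 0 < t → 0 < q.eval t) {K : ℝ} (hK : 0 < K) (hle : ∀ t, 0 < t → K * t ≤ q.eval t) :
    K ≤ Real.exp 1 * q.derivative.eval 0 := by
  have hroots (r : ℝ) (hr : r ∈ q.roots) : r ≤ 0 := by
    by_contra! h
    exact (hpos r h).ne' (Polynomial.isRoot_of_mem_roots hr)
  -- The logarithmic derivative requires `q s ≠ 0`, and `0` may be a root, so the bound is proved at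
  -- `s > 0` and passed to the limit.
  have key (s : ℝ) (hs : 0 < s) : K ≤ Real.exp 1 * q.derivative.eval s := by
    have hqs := hpos s hs
    set φ := (q.roots.map fun r => 1 / (s - r)).sum with hφ
    have hd : q.derivative.eval s = q.eval s * φ := hq.eval_derivative_eq_eval_mul_sum hqs.ne'
    have hφ0 : 0 ≤ φ := by
      refine Multiset.sum_nonneg fun y hy => ?_
      obtain ⟨r, hr, rfl⟩ := Multiset.mem_map.mp hy
      have := hroots r hr
      exact one_div_nonneg.mpr (by linarith)
    -- Each root contributes a ratio `1 + u/(s - r) ≤ exp(u/(s - r))`, and these exponents add up to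
    -- `u φ`.
    have hgrow (u : ℝ) (hu : 0 ≤ u) : q.eval (s + u) ≤ q.eval s * Real.exp (u * φ) := by
      have hlc : 0 ≤ q.leadingCoeff := by
        have := hq.eval_eq_prod_roots s
        by_contra! hneg
        refine hqs.not_ge ?_
        rw [this]
        refine mul_nonpos_of_nonpos_of_nonneg hneg.le (Multiset.prod_nonneg fun y hy => ?_)
        obtain ⟨r, hr, rfl⟩ := Multiset.mem_map.mp hy
        linarith [hroots r hr]
      rw [hq.eval_eq_prod_roots, hq.eval_eq_prod_roots s, mul_assoc]
      refine mul_le_mul_of_nonneg_left ?_ hlc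
      rw [hφ, ← Multiset.sum_map_mul_left, Real.exp_multiset_sum, Multiset.map_map,
        ← Multiset.prod_map_mul]
      refine Multiset.prod_map_le_prod_map₀ _ _ (fun r hr => ?_) fun r hr => ?_
      · linarith [hroots r hr]
      · have hsr : 0 < s - r := by linarith [hroots r hr]
        have := Real.add_one_le_exp (u * (1 / (s - r)))
        calc s + u - r = (s - r) * (u * (1 / (s - r)) + 1) := by field_simp; ring
          _ ≤ _ := by simpa using mul_le_mul_of_nonneg_left this hsr.le
    -- If `φ = 0`, then `q` stays at most `q s` beyond `s`, contradicting the linear lower bound at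
    -- `s + q(s)/K`.
    have hφpos : 0 < φ := by
      refine hφ0.lt_of_ne' fun h => ?_
      have h1 := hgrow (q.eval s / K) (by positivity)
      have h2 := hle (s + q.eval s / K) (by positivity)
      rw [h, mul_zero, Real.exp_zero, mul_one] at h1
      have : K * (s + q.eval s / K) = K * s + q.eval s := by field_simp
      nlinarith [mul_pos hK hs]
    -- The step `u = 1/φ` minimizes `exp(u φ)/u` and produces the constant `e`.
    have h1 := hgrow (1 / φ) (by positivity)
    have h2 := hle (s + 1 / φ) (by positivity)
    rw [one_div_mul_cancel hφpos.ne'] at h1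
    have h3 : K * (1 / φ) ≤ q.eval s * Real.exp 1 := by
      nlinarith [mul_pos hK hs]
    rw [hd]
    rw [mul_one_div, div_le_iff₀ hφpos] at h3
    linarith
  have hcont : Continuous fun s => Real.exp 1 * q.derivative.eval s := by fun_prop
  refine ge_of_tendsto (hcont.continuousAt.tendsto.mono_left (nhdsWithin_le_nhds (s := Set.Ioi 0))) ?_
  filter_upwards [self_mem_nhdsWithin] with s hs using key s hs

namespace MvPolynomial

variable {σ : Type*}

/-- The iterated partial derivative in the variables of a list. -/
noncomputable def listDeriv (l : List σ) (f : MvPolynomial σ ℝ) : MvPolynomial σ ℝ :=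
  l.foldr (fun j => pderiv j) f

@[simp] theorem listDeriv_cons (j : σ) (l : List σ) (f : MvPolynomial σ ℝ) :
    listDeriv (j :: l) f = pderiv j (listDeriv l f) := rfl

/-- Each listed variable goes from exponent one to zero, so differentiating creates no numerical
factor. -/
theorem coeff_listDeriv [DecidableEq σ] {l : List σ} (hl : l.Nodup) (f : MvPolynomial σ ℝ)
    (d : σ →₀ ℕ) (hd : ∀ j ∈ l, d j = 0) :
    coeff d (listDeriv l f) = coeff (d + (l.map fun j => Finsupp.single j 1).sum) f := by
  induction l generalizing d with
  | nil => simp [listDeriv]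
  | cons j l ih =>
    rw [List.nodup_cons] at hl
    rw [listDeriv_cons, coeff_pderiv, ih hl.2 _ fun i hi => ?_, hd j (by simp), List.map_cons,
      List.sum_cons, add_assoc]
    · simp
    · rw [Finsupp.add_apply, hd i (by simp [hi]),
        Finsupp.single_eq_of_ne (ne_of_mem_of_not_mem hi hl.1), add_zero]

/-- Stable homogeneous polynomials with nonnegative coefficients. -/
structure IsPosStable (f : MvPolynomial σ ℝ) (m : ℕ) : Prop where
  stable : f.IsStable
  homogeneous : f.IsHomogeneous m
  coeff_nonneg : ∀ d, 0 ≤ coeff d f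

theorem IsPosStable.pderiv [Fintype σ] {f : MvPolynomial σ ℝ} {m : ℕ}
    (hf : f.IsPosStable (m + 1)) (j : σ) : (pderiv j f).IsPosStable m where
  stable := hf.stable.pderiv hf.homogeneous j
  homogeneous := hf.homogeneous.pderiv
  coeff_nonneg d := by
    rw [coeff_pderiv]
    exact mul_nonneg (hf.coeff_nonneg _) (by positivity)

theorem IsPosStable.listDeriv [Fintype σ] {f : MvPolynomial σ ℝ} (l : List σ) {m : ℕ}
    (hf : f.IsPosStable (m + l.length)) : (listDeriv l f).IsPosStable m := by
  induction l generalizing m with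
  | nil => exact hf
  | cons j l ih =>
    refine IsPosStable.pderiv (ih ?_) j
    rwa [add_assoc, add_comm 1]

/-- Gurvits' capacity inequality: if `f` is a homogeneous stable polynomial of degree equal to the
number of variables and `f x ≥ ∏ xᵢ` on the positive orthant, then differentiating in the variables
of `l` loses at most a factor `e` for each variable. -/
theorem IsPosStable.exp_neg_mul_prod_le [Fintype σ] [DecidableEq σ] {f : MvPolynomial σ ℝ}
    (hf : f.IsPosStable (Fintype.card σ)) (hcap : ∀ x : σ → ℝ, (∀ i, 0 < x i) → ∏ i, x i ≤ aeval x f)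
    {l : List σ} (hl : l.Nodup) (x : σ → ℝ) (hx : ∀ i, 0 < x i) :
    Real.exp (-l.length) * ∏ i, (if i ∈ l then 1 else x i) ≤
      aeval (fun i => if i ∈ l then 0 else x i) (MvPolynomial.listDeriv l f) := by
  induction l generalizing x with
  | nil => simpa [MvPolynomial.listDeriv] using hcap x hx
  | cons j l ih =>
    rw [List.nodup_cons] at hl
    have hlen : l.length + 1 ≤ Fintype.card σ := by
      have : (j :: l).Nodup := List.nodup_cons.mpr hl
      simpa using this.length_le_card
    obtain ⟨m, hm⟩ := Nat.exists_eq_add_of_le' hlen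
    have hg : (MvPolynomial.listDeriv l f).IsPosStable (m + 1) := by
      refine IsPosStable.listDeriv l ?_
      rwa [add_assoc, add_comm 1, ← hm]
    set g := MvPolynomial.listDeriv l f with hgdef
    set y : σ → ℝ := fun i => if i ∈ j :: l then 0 else x i with hy
    have hy0 (i : σ) : 0 ≤ y i := by
      simp only [hy]
      split_ifs
      · exact le_rfl
      · exact (hx i).le
    set P : ℝ := ∏ i, (if i ∈ j :: l then 1 else x i) with hP
    have hPpos : 0 < P := Finset.prod_pos fun i _ => by split_ifs <;> [exact one_pos; exact hx i]
    have hpos (t : ℝ) (ht : 0 < t) : 0 < (axisLine y j g).eval t := by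
      rw [eval_axisLine]
      refine hg.stable.aeval_pos hg.homogeneous hg.coeff_nonneg (fun i => ?_) ⟨j, ?_⟩
      · by_cases h : i = j
        · subst h; simpa using add_nonneg (hy0 i) ht.le
        · simpa [h] using hy0 i
      · simpa using add_pos_of_nonneg_of_pos (hy0 j) ht
    -- The induction hypothesis with `x j` replaced by `t` is a linear lower bound in `t`, as the
    -- one-variable inequality requires.
    have hle (t : ℝ) (ht : 0 < t) :
        Real.exp (-l.length) * P * t ≤ (axisLine y j g).eval t := by
      have := ih hl.2 (Function.update x j t) fun i => by
        by_cases h : i = j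
        · subst h; simpa using ht
        · simpa [h] using hx i
      rw [eval_axisLine]
      convert! this using 1
      · rw [mul_assoc, hP, ← Finset.mul_prod_erase _ _ (Finset.mem_univ j),
          ← Finset.mul_prod_erase _ (fun i => if i ∈ l then 1 else Function.update x j t i)
            (Finset.mem_univ j)]
        have : ∏ i ∈ Finset.univ.erase j, (if i ∈ j :: l then 1 else x i) =
            ∏ i ∈ Finset.univ.erase j, (if i ∈ l then 1 else Function.update x j t i) := by
          refine Finset.prod_congr rfl fun i hi => ?_
          have := Finset.ne_of_mem_erase hi
          simp [this]
        rw [this]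
        simp [hl.1]
        ring
      · congr 1
        congr 1
        ext i
        by_cases h : i = j
        · subst h; simp [hy, hl.1]
        · simp [hy, h]
    have := (hg.stable.splits_axisLine y j).le_exp_one_mul_derivative hpos
      (mul_pos (Real.exp_pos _) hPpos) hle
    rw [derivative_axisLine, eval_axisLine, Pi.single_zero, add_zero] at this
    rw [listDeriv_cons, ← hgdef, List.length_cons, Nat.cast_succ, neg_add, Real.exp_add,
      Real.exp_neg 1]
    rw [mul_right_comm, ← div_eq_mul_inv, div_le_iff₀ (Real.exp_pos 1)]
    linarith

end MvPolynomial

/-! ### Permanents of doubly stochastic matrices. -/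

namespace Matrix

variable {ι : Type*} [Fintype ι]

/-- The product of the linear forms given by the rows of a matrix. -/
noncomputable def rowProd (A : Matrix ι ι ℝ) : MvPolynomial ι ℝ :=
  ∏ i, ∑ j, C (A i j) * X j

/-- Weighted AM–GM in each row; the column sums recombine the geometric means into `∏ x_j`. -/
theorem prod_le_aeval_rowProd {A : Matrix ι ι ℝ} (hA : ∀ i j, 0 ≤ A i j)
    (hrow : ∀ i, ∑ j, A i j = 1) (hcol : ∀ j, ∑ i, A i j = 1) {x : ι → ℝ} (hx : ∀ i, 0 < x i) :
    ∏ j, x j ≤ aeval x A.rowProd := by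
  have h : ∏ j, x j = ∏ i, ∏ j, x j ^ A i j := by
    rw [Finset.prod_comm]
    refine Finset.prod_congr rfl fun j _ => ?_
    rw [← Real.rpow_sum_of_pos (hx j), hcol, Real.rpow_one]
  rw [h, rowProd, map_prod]
  refine Finset.prod_le_prod (fun i _ => Finset.prod_nonneg fun j _ =>
    Real.rpow_nonneg (hx j).le _) fun i _ => ?_
  simpa using Real.geom_mean_le_arith_mean_weighted Finset.univ (A i) x (fun j _ => hA i j)
    (hrow i) fun j _ => (hx j).le

variable [DecidableEq ι]

theorem coeff_one_rowProd (A : Matrix ι ι ℝ) :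
    coeff (Finsupp.equivFunOnFinite.symm fun _ => 1) A.rowProd = A.permanent := by
  have h : A.rowProd = ∑ p : ι → ι, monomial (∑ i, Finsupp.single (p i) 1) (∏ i, A i (p i)) := by
    rw [rowProd, Finset.prod_univ_sum, Fintype.piFinset_univ]
    refine Finset.sum_congr rfl fun p _ => ?_
    rw [monomial_sum_prod]
    exact Finset.prod_congr rfl fun i _ => C_mul_X_eq_monomial
  rw [h, coeff_sum, ← permanent_transpose, permanent]
  symm
  refine Fintype.sum_of_injective (fun τ : Equiv.Perm ι => (τ : ι → ι)) DFunLike.coe_injective _ _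
    (fun p hp => ?_) fun τ => ?_
  · rw [coeff_monomial, if_neg]
    intro hsum
    have hsurj : Function.Surjective p := by
      intro j
      have := DFunLike.congr_fun hsum j
      by_contra! hj
      simp [Finsupp.finsetSum_apply, hj] at this
    exact hp ⟨Equiv.ofBijective p (Finite.surjective_iff_bijective.mp hsurj), rfl⟩
  · rw [coeff_monomial, if_pos]
    · rfl
    · ext j
      rw [Equiv.sum_comp τ fun i => Finsupp.single i 1]
      simp [Finsupp.finsetSum_apply, Finsupp.single_apply]

/-- With strictly positive entries, each row form has positive imaginary part as soon as one `z j`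
does, so no factor vanishes. -/
theorem isPosStable_rowProd [Nonempty ι] {A : Matrix ι ι ℝ} (hA : ∀ i j, 0 < A i j) :
    A.rowProd.IsPosStable (Fintype.card ι) where
  stable z hz hz' := by
    rw [rowProd, map_prod, Finset.prod_ne_zero_iff]
    intro i _ h0
    have him := congrArg Complex.im h0
    simp only [map_sum, map_mul, aeval_X, Complex.im_sum, algHom_C, Complex.coe_algebraMap,
      Complex.im_ofReal_mul, Complex.zero_im] at him
    obtain ⟨j, hj⟩ := hz'
    exact (Finset.sum_pos' (fun j _ => mul_nonneg (hA i j).le (hz j))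
      ⟨j, Finset.mem_univ j, mul_pos (hA i j) hj⟩).ne' him
  homogeneous := by
    have := IsHomogeneous.prod Finset.univ (fun i => ∑ j, C (A i j) * X j) (fun _ => 1)
      fun i _ => IsHomogeneous.sum _ _ _ fun j _ => isHomogeneous_C_mul_X _ _
    simpa [rowProd] using this
  coeff_nonneg := by
    have hmul (f g : MvPolynomial ι ℝ) (hf : ∀ d, 0 ≤ coeff d f) (hg : ∀ d, 0 ≤ coeff d g) (d) :
        0 ≤ coeff d (f * g) := by
      rw [coeff_mul]
      exact Finset.sum_nonneg fun _ _ => mul_nonneg (hf _) (hg _)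
    refine Finset.prod_induction _ (fun f : MvPolynomial ι ℝ => ∀ d, 0 ≤ coeff d f) hmul
      (fun d => ?_) fun i _ d => ?_
    · rw [coeff_one]
      split_ifs <;> simp
    · rw [coeff_sum]
      refine Finset.sum_nonneg fun j _ => ?_
      rw [coeff_C_mul, coeff_X]
      refine mul_nonneg (hA i j).le ?_
      split_ifs <;> simp

/-- Gurvits' inequality is used with all variables differentiated: each costs a factor `e`, and the
remaining constant is the permanent. -/
theorem exp_neg_card_le_permanent_of_pos [Nonempty ι] {A : Matrix ι ι ℝ} (hA : ∀ i j, 0 < A i j)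
    (hrow : ∀ i, ∑ j, A i j = 1) (hcol : ∀ j, ∑ i, A i j = 1) :
    Real.exp (-Fintype.card ι) ≤ A.permanent := by
  have h := (isPosStable_rowProd hA).exp_neg_mul_prod_le
    (fun x hx => prod_le_aeval_rowProd (fun i j => (hA i j).le) hrow hcol hx)
    (Finset.nodup_toList Finset.univ) 1 fun _ => one_pos
  simp only [Finset.length_toList, Finset.mem_toList, Finset.mem_univ, if_true, Finset.prod_const_one,
    mul_one, Finset.card_univ] at h
  refine h.trans_eq ?_
  rw [← coeff_one_rowProd, show (fun _ : ι => (0 : ℝ)) = 0 from rfl, aeval_zero, constantCoeff_eq,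
    Algebra.algebraMap_self, RingHom.id_apply, coeff_listDeriv (Finset.nodup_toList _) _ _ (by simp)]
  congr 1
  rw [Finset.sum_map_toList, zero_add]
  ext j
  simp [Finsupp.finsetSum_apply, Finsupp.single_apply]

/-- A weak form of van der Waerden's conjecture: the permanent of a doubly stochastic matrix of size
`n` is at least `e⁻ⁿ`. -/
theorem exp_neg_card_le_permanent {A : Matrix ι ι ℝ} (hA : ∀ i j, 0 ≤ A i j)
    (hrow : ∀ i, ∑ j, A i j = 1) (hcol : ∀ j, ∑ i, A i j = 1) :
    Real.exp (-Fintype.card ι) ≤ A.permanent := by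
  cases isEmpty_or_nonempty ι
  · simp [permanent_isEmpty]
  have hN : (0 : ℝ) < Fintype.card ι := by exact_mod_cast Fintype.card_pos
  -- Mixing with the uniform doubly stochastic matrix makes the entries positive for `0 < t < 1`;
  -- continuity at `t = 0` recovers `A`.
  let B (t : ℝ) : Matrix ι ι ℝ := Matrix.of fun i j => (1 - t) * A i j + t / Fintype.card ι
  have hcont : Continuous fun t => (B t).permanent := by
    simp only [permanent, B, of_apply]
    fun_prop
  have h0 : (B 0).permanent = A.permanent := by
    congr 1
    ext i j
    simp [B]
  rw [← h0]
  refine ge_of_tendsto (hcont.continuousAt.tendsto.mono_left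
    (nhdsWithin_le_nhds (s := Set.Ioi 0))) ?_
  filter_upwards [Ioo_mem_nhdsGT (zero_lt_one' ℝ)] with t ht
  refine exp_neg_card_le_permanent_of_pos (fun i j => ?_) (fun i => ?_) fun j => ?_
  · exact add_pos_of_nonneg_of_pos (mul_nonneg (by linarith [ht.2]) (hA i j)) (div_pos ht.1 hN)
  · simp [B, Finset.sum_add_distrib, ← Finset.mul_sum, hrow]
    field_simp
    ring
  · simp [B, Finset.sum_add_distrib, ← Finset.mul_sum, hcol]
    field_simp
    ring

end Matrix

/-! ### Extending Latin rectangles: the lower bound for the number of Latin squares. -/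

/-- `k × n` Latin rectangles, as families of row permutations. -/
abbrev LatinRectangle (k n : ℕ) : Type :=
  {r : Fin k → Equiv.Perm (Fin n) // ∀ j, Function.Injective fun i => r i j}

theorem card_forall_ne_of_injective {k n : ℕ} {f : Fin k → Fin n} (hf : Function.Injective f) :
    ((Finset.univ.filter fun c => ∀ i, c ≠ f i).card : ℝ) = n - k := by
  have h : (Finset.univ.filter fun c => ∀ i, c ≠ f i) = (Finset.univ.image f)ᶜ := by
    ext c
    simp [eq_comm]
  have hk : k ≤ n := by simpa using Fintype.card_le_of_injective f hf
  rw [h, Finset.card_compl, Finset.card_image_of_injective _ hf]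
  simp [Nat.cast_sub hk]

namespace LatinRectangle

/-- The availability matrix of a Latin rectangle. -/
def available {k n : ℕ} (r : LatinRectangle k n) : Matrix (Fin n) (Fin n) ℝ :=
  Matrix.of fun c j => if ∀ i, c ≠ r.1 i j then 1 else 0

theorem permanent_available {k n : ℕ} (r : LatinRectangle k n) :
    r.available.permanent = Nat.card {τ : Equiv.Perm (Fin n) // ∀ j i, τ j ≠ r.1 i j} := by
  classical
  rw [Nat.card_eq_fintype_card, Fintype.card_subtype, Finset.natCast_card_filter, Matrix.permanent]
  refine Finset.sum_congr rfl fun τ _ => ?_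
  simp [available, Finset.prod_boole]

/-- Each column has `n - k` unused symbols, and each symbol is missing from `n - k` columns.
Dividing the availability matrix by `n - k` therefore makes it doubly stochastic. -/
theorem pow_le_card_extension {k n : ℕ} (hk : k < n) (r : LatinRectangle k n) :
    (((n : ℝ) - k) / Real.exp 1) ^ n ≤
      Nat.card {τ : Equiv.Perm (Fin n) // ∀ j i, τ j ≠ r.1 i j} := by
  have hd : (0 : ℝ) < n - k := sub_pos.mpr (by exact_mod_cast hk)
  have hcol (j : Fin n) : ∑ c, r.available c j = n - k := by
    rw [← card_forall_ne_of_injective (r.2 j), Finset.natCast_card_filter]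
    rfl
  have hrow (c : Fin n) : ∑ j, r.available c j = n - k := by
    have hinj : Function.Injective fun i => (r.1 i).symm c := by
      intro i i' h
      refine r.2 ((r.1 i).symm c) ?_
      change r.1 i _ = r.1 i' _
      rw [Equiv.apply_symm_apply, show (r.1 i).symm c = (r.1 i').symm c from h,
        Equiv.apply_symm_apply]
    rw [← card_forall_ne_of_injective hinj, Finset.natCast_card_filter]
    refine Finset.sum_congr rfl fun j _ => ?_
    simp [available, Equiv.eq_symm_apply, eq_comm]
  have h := Matrix.exp_neg_card_le_permanent (A := ((n : ℝ) - k)⁻¹ • r.available)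
    (fun c j => ?_) (fun c => ?_) fun j => ?_
  · rw [Matrix.permanent_smul, permanent_available, Fintype.card_fin] at h
    rw [div_pow, ← Real.exp_nat_mul, mul_one, div_eq_mul_inv, ← Real.exp_neg]
    calc ((n : ℝ) - k) ^ n * Real.exp (-n) ≤ ((n : ℝ) - k) ^ n * _ :=
          mul_le_mul_of_nonneg_left h (by positivity)
      _ = _ := by rw [← mul_assoc, ← mul_pow, mul_inv_cancel₀ hd.ne', one_pow, one_mul]
  · refine mul_nonneg (inv_nonneg.mpr hd.le) ?_
    simp only [available, Matrix.of_apply]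
    split_ifs <;> simp
  · simp only [Matrix.smul_apply, smul_eq_mul, ← Finset.mul_sum, hrow, inv_mul_cancel₀ hd.ne']
  · simp only [Matrix.smul_apply, smul_eq_mul, ← Finset.mul_sum, hcol, inv_mul_cancel₀ hd.ne']

theorem card_succ_ge {k n : ℕ} (hk : k < n) :
    (Nat.card (LatinRectangle k n) : ℝ) * (((n : ℝ) - k) / Real.exp 1) ^ n ≤
      Nat.card (LatinRectangle (k + 1) n) := by
  classical
  let ext (x : Σ r : LatinRectangle k n, {τ : Equiv.Perm (Fin n) // ∀ j i, τ j ≠ r.1 i j}) :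
      LatinRectangle (k + 1) n := ⟨Fin.cons x.2.1 x.1.1, fun j => by
    have : (fun i => (Fin.cons x.2.1 x.1.1 : Fin (k + 1) → Equiv.Perm (Fin n)) i j) =
        Fin.cons (x.2.1 j) fun i => x.1.1 i j := by
      ext i
      cases i using Fin.cases <;> rfl
    rw [this, Fin.cons_injective_iff]
    refine ⟨?_, x.1.2 j⟩
    rintro ⟨i, hi⟩
    exact x.2.2 j i hi.symm⟩
  have hext : Function.Injective ext := by
    rintro ⟨⟨r, hr⟩, τ, hτ⟩ ⟨⟨r', hr'⟩, τ', hτ'⟩ h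
    have hcons : (Fin.cons τ r : Fin (k + 1) → Equiv.Perm (Fin n)) = Fin.cons τ' r' :=
      congrArg Subtype.val h
    obtain ⟨h1, h2⟩ := Fin.cons_injective2 hcons
    subst h1 h2
    rfl
  have h := Nat.card_le_card_of_injective ext hext
  rw [Nat.card_sigma] at h
  have h' : (∑ r : LatinRectangle k n,
      (Nat.card {τ : Equiv.Perm (Fin n) // ∀ j i, τ j ≠ r.1 i j} : ℝ)) ≤
      Nat.card (LatinRectangle (k + 1) n) := by exact_mod_cast h
  refine le_trans ?_ h'
  rw [Nat.card_eq_fintype_card, ← Finset.card_univ, ← nsmul_eq_mul]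
  exact Finset.card_nsmul_le_sum _ _ _ fun r _ => pow_le_card_extension hk r

theorem prod_le_card {k n : ℕ} (hk : k ≤ n) :
    ∏ i ∈ Finset.range k, (((n : ℝ) - i) / Real.exp 1) ^ n ≤ Nat.card (LatinRectangle k n) := by
  induction k with
  | zero =>
    have : Nat.card (LatinRectangle 0 n) ≠ 0 :=
      Nat.card_ne_zero.mpr ⟨⟨⟨Fin.elim0, fun _ i => i.elim0⟩⟩, inferInstance⟩
    rw [Finset.prod_range_zero]
    exact_mod_cast Nat.one_le_iff_ne_zero.mpr this
  | succ k ih =>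
    rw [Finset.prod_range_succ]
    have : (0 : ℝ) ≤ n - k := sub_nonneg.mpr (by exact_mod_cast (Nat.lt_of_succ_le hk).le)
    exact (mul_le_mul_of_nonneg_right (ih (Nat.le_of_succ_le hk)) (by positivity)).trans
      (card_succ_ge hk)

theorem card_self_le_numLatin (n : ℕ) : Nat.card (LatinRectangle n n) ≤ numLatin n := by
  refine Nat.card_le_card_of_injective (β := LatinSquare n)
    (fun r => ⟨Matrix.of fun i j => r.1 i j, fun i => (r.1 i).bijective,
      fun j => Finite.injective_iff_bijective.mp (r.2 j)⟩) fun r r' h => ?_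
  refine Subtype.ext (funext fun i => Equiv.ext fun j => ?_)
  exact congrFun (congrFun (congrArg Subtype.val h) i) j

end LatinRectangle

/-- The product over the rows is `(n!/eⁿ)ⁿ`, and `n! ≥ (n/e)ⁿ` follows from one term of the
exponential series. -/
theorem pow_le_numLatin (n : ℕ) : ((n : ℝ) / Real.exp 2) ^ n ^ 2 ≤ numLatin n := by
  refine le_trans ?_ ((LatinRectangle.prod_le_card le_rfl).trans
    (Nat.cast_le.mpr (LatinRectangle.card_self_le_numLatin n)))
  have hfac : ∏ i ∈ Finset.range n, ((n : ℝ) - i) = n.factorial := by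
    rw [← Nat.descFactorial_self, Nat.descFactorial_eq_prod_range, Nat.cast_prod]
    refine Finset.prod_congr rfl fun i hi => ?_
    rw [Nat.cast_sub (Finset.mem_range.mp hi).le]
  rw [Finset.prod_pow, Finset.prod_div_distrib, hfac, Finset.prod_const, Finset.card_range, pow_two,
    pow_mul]
  refine pow_le_pow_left₀ (by positivity) ?_ n
  have h := Real.pow_div_factorial_le_exp (n : ℝ) (Nat.cast_nonneg n) n
  have hf : (0 : ℝ) < n.factorial := by exact_mod_cast n.factorial_pos
  rw [div_le_iff₀ hf] at h
  rw [div_pow, ← Real.exp_nat_mul, ← Real.exp_nat_mul, div_le_div_iff₀ (Real.exp_pos _)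
    (Real.exp_pos _), mul_one, mul_two, Real.exp_add]
  nlinarith [Real.exp_pos (n : ℝ)]

/-! ### Asymptotics of the Fischer norm. -/

theorem one_div_succ_le_log_succ_sub_log {x : ℝ} (hx : 0 < x) :
    1 / (x + 1) ≤ Real.log (x + 1) - Real.log x := by
  have h := Real.log_le_sub_one_of_pos (show 0 < x / (x + 1) by positivity)
  rw [Real.log_div hx.ne' (by positivity)] at h
  have : x / (x + 1) - 1 = -(1 / (x + 1)) := by field_simp; ring
  linarith

theorem log_factorial_le {n : ℕ} (hn : 1 ≤ n) :
    Real.log n.factorial ≤ 1 + (n + 1) * Real.log n - n := by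
  induction n, hn using Nat.le_induction with
  | base => simp
  | succ n hn ih =>
    have hn0 : (0 : ℝ) < n := by exact_mod_cast hn
    rw [Nat.factorial_succ, Nat.cast_mul, Real.log_mul (by positivity) (by positivity)]
    push_cast
    have h := one_div_succ_le_log_succ_sub_log hn0
    rw [div_le_iff₀ (by positivity)] at h
    nlinarith

theorem ascFactorial_succ_self_le (n : ℕ) : (n + 1).ascFactorial n ≤ 4 ^ n * n.factorial := by
  have h1 := Nat.factorial_mul_ascFactorial n n
  have h2 := Nat.add_choose_mul_factorial_mul_factorial n n
  have h3 : (n + n).choose n ≤ 4 ^ n := by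
    refine (Nat.choose_le_two_pow _ _).trans_eq ?_
    rw [← two_mul, pow_mul]
    norm_num
  refine Nat.le_of_mul_le_mul_left ?_ n.factorial_pos
  calc n.factorial * (n + 1).ascFactorial n = (n + n).choose n * (n.factorial * n.factorial) := by
        rw [h1, ← h2, mul_assoc]
    _ ≤ 4 ^ n * (n.factorial * n.factorial) := Nat.mul_le_mul_right _ h3
    _ = _ := by ring

/-- Lengthening the `n` old factors contributes `(n+1)⋯(2n)` in total, and the new factor is
`(n+1)⋯(2n+1)`. -/
theorem prod_ascFactorial_succ (n : ℕ) :
    ∏ i ∈ Finset.range (n + 1), (i + 1).ascFactorial (n + 1) =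
      (∏ i ∈ Finset.range n, (i + 1).ascFactorial n) *
        ((n + 1).ascFactorial n * (n + 1).ascFactorial n * (2 * n + 1)) := by
  rw [Finset.prod_range_succ, Nat.ascFactorial_succ]
  have : ∏ i ∈ Finset.range n, (i + 1).ascFactorial (n + 1) =
      (n + 1).ascFactorial n * ∏ i ∈ Finset.range n, (i + 1).ascFactorial n := by
    rw [Nat.ascFactorial_eq_prod_range (n + 1), ← Finset.prod_mul_distrib]
    refine Finset.prod_congr rfl fun i _ => ?_
    rw [Nat.ascFactorial_succ]
    ring
  rw [this]
  ring

/-- The relative error in the exponent of the bounds below. -/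
noncomputable def expError (n : ℕ) : ℝ := (2 + 3 * Real.log (2 * n + 1)) / n

theorem sq_mul_expError (n : ℕ) :
    (n : ℝ) ^ 2 * expError n = n * (2 + 3 * Real.log (2 * n + 1)) := by
  rcases eq_or_ne (n : ℝ) 0 with h | h
  · simp [h]
  · rw [expError]
    field_simp

theorem tendsto_expError : Tendsto expError atTop (𝓝 0) := by
  have h1 : Tendsto (fun n : ℕ => (2 : ℝ) / n) atTop (𝓝 0) :=
    tendsto_const_div_atTop_nhds_zero_nat 2
  have h2 := (Real.tendsto_pow_log_div_mul_add_atTop (1 / 2) (-1 / 2) 1 (by norm_num)).comp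
    (tendsto_atTop_add_const_right _ (1 : ℝ)
      (tendsto_natCast_atTop_atTop.const_mul_atTop (zero_lt_two' ℝ)) : Tendsto
      (fun n : ℕ => 2 * (n : ℝ) + 1) atTop atTop)
  have h3 := h1.add (h2.const_mul 3)
  rw [mul_zero, add_zero] at h3
  refine h3.congr fun n => ?_
  have : (1 / 2 : ℝ) * (2 * n + 1) + -1 / 2 = n := by ring
  rw [Function.comp_apply, pow_one, this, expError]
  ring

/-- By the recursion, the logarithm grows by about `2n log n + 2n log 4 - 2n`. Since `n² log n + c
n²` grows by about `2n log n + n + 2cn`, this forces `c = log 4 - 3/2`; the error term absorbs the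
lower-order discrepancies. -/
theorem log_prod_ascFactorial_le {n : ℕ} (hn : 1 ≤ n) :
    Real.log (∏ i ∈ Finset.range n, (i + 1).ascFactorial n : ℕ) ≤
      n ^ 2 * (Real.log n + Real.log 4 - 3 / 2 + expError n) := by
  rw [mul_add, sq_mul_expError]
  have hlog4 : 1 ≤ Real.log 4 := by
    rw [show (4 : ℝ) = 2 ^ 2 by norm_num, Real.log_pow]
    have := Real.log_two_gt_d9
    push_cast
    linarith
  induction n, hn using Nat.le_induction with
  | base =>
    have : 0 ≤ Real.log (2 * ((1 : ℕ) : ℝ) + 1) := Real.log_nonneg (by norm_num)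
    norm_num at this ⊢
    linarith
  | succ n hn ih =>
    have hn0 : (0 : ℝ) < n := by exact_mod_cast hn
    have hn1 : (1 : ℝ) ≤ n := by exact_mod_cast hn
    have hA0 : (0 : ℝ) < (n + 1).ascFactorial n := by
      exact_mod_cast Nat.ascFactorial_pos _ _
    have hA : Real.log ((n + 1).ascFactorial n) ≤
        n * Real.log 4 + (1 + (n + 1) * Real.log n - n) := by
      have hle : ((n + 1).ascFactorial n : ℝ) ≤ 4 ^ n * n.factorial := by
        exact_mod_cast ascFactorial_succ_self_le n
      refine (Real.log_le_log hA0 hle).trans ?_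
      rw [Real.log_mul (by positivity) (by positivity), Real.log_pow]
      linarith [log_factorial_le hn]
    have hF0 : ((∏ i ∈ Finset.range n, (i + 1).ascFactorial n : ℕ) : ℝ) ≠ 0 := by
      exact_mod_cast (Finset.prod_pos fun i _ => Nat.ascFactorial_pos _ _).ne'
    rw [prod_ascFactorial_succ, Nat.cast_mul, Nat.cast_mul, Nat.cast_mul,
      Real.log_mul hF0 (by positivity), Real.log_mul (by positivity) (by positivity),
      Real.log_mul hA0.ne' hA0.ne']
    push_cast
    have h1 := one_div_succ_le_log_succ_sub_log hn0
    rw [div_le_iff₀ (by positivity)] at h1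
    have h2 : Real.log n ≤ Real.log (2 * (n : ℝ) + 1) := Real.log_le_log hn0 (by linarith)
    have h3 : Real.log (2 * (n : ℝ) + 1) ≤ Real.log (2 * ((n : ℝ) + 1) + 1) :=
      Real.log_le_log (by positivity) (by linarith)
    have h4 : 0 ≤ Real.log (n : ℝ) := Real.log_nonneg hn1
    push_cast at ih
    set a := Real.log (n : ℝ)
    set b := Real.log ((n : ℝ) + 1)
    set c := Real.log (2 * (n : ℝ) + 1)
    set d := Real.log (2 * ((n : ℝ) + 1) + 1)
    have h5 := mul_le_mul_of_nonneg_right h1 (show (0 : ℝ) ≤ n + 1 by positivity)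
    have h6 := mul_le_mul_of_nonneg_left h3 (show (0 : ℝ) ≤ n + 1 by positivity)
    nlinarith

/-! ### Comparison of the two bounds. -/

theorem abs_numEvenLatin_sub_numOddLatin_le {n : ℕ} (hn : 1 ≤ n) :
    |(numEvenLatin n : ℝ) - numOddLatin n| ≤
      Real.exp ((n : ℝ) ^ 2 / 2 * (Real.log n + Real.log 4 - 3 / 2 + expError n)) := by
  have hF0 : (0 : ℝ) < (∏ i ∈ Finset.range n, (i + 1).ascFactorial n : ℕ) := by
    exact_mod_cast Finset.prod_pos fun i _ => Nat.ascFactorial_pos _ _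
  refine abs_le_of_sq_le_sq ?_ (Real.exp_pos _).le
  refine (sq_numEvenLatin_sub_numOddLatin_le n).trans ?_
  rw [← Nat.cast_prod, ← Real.exp_nat_mul, ← Real.log_le_iff_le_exp hF0]
  refine (log_prod_ascFactorial_le hn).trans_eq ?_
  push_cast
  ring

theorem exp_le_numLatin {n : ℕ} (hn : 1 ≤ n) :
    Real.exp ((n : ℝ) ^ 2 * (Real.log n - 2)) ≤ numLatin n := by
  have hn0 : (0 : ℝ) < n := by exact_mod_cast hn
  refine le_of_eq_of_le ?_ (pow_le_numLatin n)
  have h : (n : ℝ) / Real.exp 2 = Real.exp (Real.log n - 2) := by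
    rw [Real.exp_sub, Real.exp_log hn0]
  rw [h, ← Real.exp_nat_mul]
  push_cast
  rfl

theorem abs_numEvenLatin_sub_numOddLatin_le_rpow (n : ℕ) :
    |(numEvenLatin n : ℝ) - numOddLatin n| ≤ (numLatin n : ℝ) ^ (1 / 2 : ℝ) *
      (2 * Real.exp (1 / 4)) ^ ((n : ℝ) ^ 2 * (1 + expError n)) := by
  rcases Nat.eq_zero_or_pos n with rfl | hn
  · have h := pow_le_numLatin 0
    have h' := sq_numEvenLatin_sub_numOddLatin_le 0
    simp only [Finset.range_zero, Finset.prod_empty] at h'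
    have h1 : 1 ≤ (numLatin 0 : ℝ) ^ (1 / 2 : ℝ) := Real.one_le_rpow (by simpa using h) (by norm_num)
    refine (abs_le_one_iff_mul_self_le_one.mpr (by rwa [← sq])).trans ?_
    simpa using h1
  · have hL := exp_le_numLatin hn
    refine (abs_numEvenLatin_sub_numOddLatin_le hn).trans ?_
    have hbase : (2 : ℝ) * Real.exp (1 / 4) = Real.exp (Real.log 2 + 1 / 4) := by
      rw [Real.exp_add, Real.exp_log two_pos]
    rw [hbase, ← Real.exp_mul]
    refine le_trans ?_ (mul_le_mul_of_nonneg_right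
      (Real.rpow_le_rpow (Real.exp_pos _).le hL (by norm_num)) (Real.exp_pos _).le)
    rw [← Real.exp_mul, ← Real.exp_add, Real.exp_le_exp]
    -- The main terms of the exponents agree exactly. The error has coefficient `1/2` on the left
    -- and `log 2 + 1/4 > 1/2` on the right, so its nonnegativity suffices.
    have hε : 0 ≤ (n : ℝ) ^ 2 * expError n := by
      rw [sq_mul_expError]
      have : 0 ≤ Real.log (2 * (n : ℝ) + 1) := Real.log_nonneg (by linarith [n.cast_nonneg (α := ℝ)])
      positivity
    have hlog4 : Real.log 4 = 2 * Real.log 2 := by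
      rw [show (4 : ℝ) = 2 ^ 2 by norm_num, Real.log_pow]
      norm_num
    have := Real.log_two_gt_d9
    rw [hlog4]
    nlinarith

/-- This is the exponent bounding the discrepancy minus that bounding `L(n)` from below, with `5/2 =
4 - 3/2`; the term `-log n` wins. -/
theorem tendsto_discrepancy_exponent :
    Tendsto (fun n : ℕ => (n : ℝ) ^ 2 / 2 * (Real.log 4 + 5 / 2 + expError n - Real.log n))
      atTop atBot := by
  have h1 : Tendsto (fun n : ℕ => (n : ℝ) ^ 2 / 2) atTop atTop :=
    ((tendsto_pow_atTop two_ne_zero).comp tendsto_natCast_atTop_atTop).atTop_div_const two_pos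
  have h2 : Tendsto (fun n : ℕ => Real.log 4 + 5 / 2 + expError n + -Real.log n) atTop atBot :=
    (tendsto_expError.const_add (Real.log 4 + 5 / 2)).add_atBot
      (tendsto_neg_atTop_atBot.comp (Real.tendsto_log_atTop.comp tendsto_natCast_atTop_atTop))
  exact h1.atTop_mul_atBot₀ h2

theorem numEvenLatin_isEquivalent_numOddLatin :
    (fun n : ℕ => (numEvenLatin n : ℝ)) ~[atTop] (fun n : ℕ => (numOddLatin n : ℝ)) := by
  refine isLittleO_iff.mpr fun c hc => ?_
  -- Write `D` for the discrepancy. From `(2 + c)|D| ≤ c(L^even + L^odd) ≤ c(2 L^odd + |D|)` follows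
  -- `|D| ≤ c L^odd`.
  have hδ : 0 < c / (2 + c) := by positivity
  filter_upwards [(Real.tendsto_exp_atBot.comp tendsto_discrepancy_exponent).eventually_le_const hδ,
    eventually_ge_atTop 1] with n hn hn1
  have hD := abs_numEvenLatin_sub_numOddLatin_le hn1
  have hL := exp_le_numLatin hn1
  have hDL : |(numEvenLatin n : ℝ) - numOddLatin n| ≤ c / (2 + c) * numLatin n := by
    refine hD.trans (le_trans (le_of_eq ?_) (mul_le_mul hn hL (Real.exp_pos _).le hδ.le))
    rw [Function.comp_apply, ← Real.exp_add]
    ring_nf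
  rw [← numEvenLatin_add_numOddLatin, div_mul_eq_mul_div, le_div_iff₀ (by positivity)] at hDL
  simp only [Pi.sub_apply, Real.norm_eq_abs, Nat.abs_cast]
  have h := le_abs_self ((numEvenLatin n : ℝ) - numOddLatin n)
  nlinarith

theorem corollary3 :
    (∃ ε : ℕ → ℝ, Tendsto ε atTop (𝓝 0) ∧
      ∀ n : ℕ, |(numEvenLatin n : ℝ) - (numOddLatin n : ℝ)| ≤
        (numLatin n : ℝ) ^ (1 / 2 : ℝ) *
          (2 * Real.exp (1 / 4)) ^ ((n : ℝ) ^ 2 * (1 + ε n))) ∧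
    (fun n : ℕ => (numEvenLatin n : ℝ)) ~[atTop] (fun n : ℕ => (numOddLatin n : ℝ)) :=
  ⟨⟨expError, tendsto_expError, abs_numEvenLatin_sub_numOddLatin_le_rpow⟩,
    numEvenLatin_isEquivalent_numOddLatin⟩
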